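/- Let $\mathcal P$ be a combinatorial type of dimension $d$ (a lattice isomorphic to the face lattice of some $d$-dimensional convex polytope) with $m$ facets $F_1,\dots,F_m$, and let $0\le k<d$. For a face $G$ of $\mathcal P$ put $I(G)=\{i\in[m] : G\le F_i\}$, and let $$\Sigma_k=\{\tau\subseteq[m] : \tau\cap I(G)=\emptyset\ \text{for some } k\text{-dimensional face } G\in\mathcal P\}$$ be the $k$-th coskeleton complex of $\mathcal P$, a simplicial complex. For a finite simplicial complex $K$ let $\operatorname{Edim}(K)$ be the smallest integer $N\ge 0$ such that the geometric realization $\|K\|$ is homeomorphic to a closed subset of the $N$-sphere $S^N$. If $P$ is a polytope and $\pi$ is an affine map on $P$, a proper face $F$ of $P$ is called strictly preserved under $\pi$ if $G=\pi(F)$ is a proper face of $\pi(P)$, $F$ and $G$ are combinatorially isomorphic (have isomorphic face lattices), and $P\cap\pi^{-1}(G)=F$. The map $\pi$ retains the $k$-skeleton of $P$ if every face of $P$ of dimension at most $k$ is strictly preserved under $\pi$. Let $e\ge 0$ be an integer. If $$e<\operatorname{Edim}(\Sigma_k)+d-m+2,$$ then there are no realization $P$ of $\mathcal P$ (that is, a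 polytope $P\subset\mathbb R^n$, for any $n$, with face lattice isomorphic to $\mathcal P$) and affine map $\pi:\mathbb R^n\to\mathbb R^e$ such that $\pi$ retains the $k$-skeleton of $P$. -/

import Mathlib

open Topology

/-! ### Polytopes and their faces -/

/-- A polytope: the convex hull of finitely many points. -/
def IsPolytope {n : ℕ} (P : Set (EuclideanSpace ℝ (Fin n))) : Prop :=
  ∃ V : Finset (EuclideanSpace ℝ (Fin n)), P = convexHull ℝ (V : Set (EuclideanSpace ℝ (Fin n)))

open Classical in
/-- The dimension of a set: the dimension of its affine span, with `dim ∅ = -1`. -/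
noncomputable def polyDim {n : ℕ} (S : Set (EuclideanSpace ℝ (Fin n))) : ℤ :=
  if S = ∅ then -1 else (Module.finrank ℝ (vectorSpan ℝ S) : ℤ)

/-- The face lattice of `P`, ordered by inclusion. Mathlib's `IsExposed ℝ P F` says that `F` is empty
or is the set of maximizers on `P` of a linear functional; the zero functional gives `P` itself. So
the faces are `∅`, `P`, and the intersections of `P` with its supporting hyperplanes. -/
abbrev FaceLattice {n : ℕ} (P : Set (EuclideanSpace ℝ (Fin n))) : Type :=
  {F : Set (EuclideanSpace ℝ (Fin n)) // IsExposed ℝ P F}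

/-- Combinatorial isomorphism: isomorphic face lattices. -/
def CombIso {n n' : ℕ} (P : Set (EuclideanSpace ℝ (Fin n)))
    (Q : Set (EuclideanSpace ℝ (Fin n'))) : Prop :=
  Nonempty (FaceLattice P ≃o FaceLattice Q)

/-! ### Combinatorial types -/

/-- `P` is a realization of `L`: a polytope whose face lattice is isomorphic to `L`. -/
def IsRealization (L : Type*) [PartialOrder L] {n : ℕ}
    (P : Set (EuclideanSpace ℝ (Fin n))) : Prop :=
  IsPolytope P ∧ Nonempty (L ≃o FaceLattice P)

/-- `L` is a combinatorial type of dimension `d`: it is isomorphic to the face lattice of some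
`d`-dimensional polytope (so it is in particular a graded lattice). -/
def IsCombinatorialType (L : Type*) [PartialOrder L] (d : ℕ) : Prop :=
  ∃ (n : ℕ) (P : Set (EuclideanSpace ℝ (Fin n))), IsRealization L P ∧ polyDim P = d

/-- `G` is a `k`-face of the combinatorial type `L`: the bottom of the graded lattice is the empty
face, of dimension `-1` and height `0`, so a `k`-face is an element of height `k + 1`. -/
def IsKFace {L : Type*} [PartialOrder L] (k : ℕ) (G : L) : Prop :=
  Order.height G = (k : ℕ∞) + 1

/-- The facet-incidences of a face `G`, where the facets (coatoms) are indexed by `Fin m`. -/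
def facetIncidences {L : Type*} [PartialOrder L] [OrderTop L] {m : ℕ}
    (facet : Fin m ≃ {F : L // IsCoatom F}) (G : L) : Set (Fin m) :=
  {i | G ≤ (facet i : L)}

/-- The `k`-th coskeleton complex: all sets of facets that are disjoint from the
facet-incidences of some `k`-face (as a Mathlib complex it lists the non-empty simplices only). -/
def coskeleton {L : Type*} [PartialOrder L] [OrderTop L] {m : ℕ}
    (facet : Fin m ≃ {F : L // IsCoatom F}) (k : ℕ) : PreAbstractSimplicialComplex (Fin m) where
  faces := {τ | τ.Nonempty ∧
    ∃ G : L, IsKFace k G ∧ Disjoint (τ : Set (Fin m)) (facetIncidences facet G)}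
  isRelLowerSet_faces := by
    rintro τ ⟨hτ, G, hG, hd⟩
    exact ⟨hτ, fun σ hσ hne => ⟨hne, G, hG, hd.mono_left (by exact_mod_cast hσ)⟩⟩

/-! ### Embeddability dimension -/

/-- The geometric realization of a complex on the vertex set `Fin m`: the points of the standard
simplex that are supported on a simplex of the complex. -/
def geomRealization {m : ℕ} (K : PreAbstractSimplicialComplex (Fin m)) : Set (Fin m → ℝ) :=
  {x | x ∈ stdSimplex ℝ (Fin m) ∧ ∃ τ ∈ K.faces, ∀ i, i ∉ τ → x i = 0}

/-- The realization of `K` is homeomorphic to a closed subset of the `N`-sphere. -/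
def EmbedsInSphere {m : ℕ} (K : PreAbstractSimplicialComplex (Fin m)) (N : ℕ) : Prop :=
  ∃ f : geomRealization K → Metric.sphere (0 : EuclideanSpace ℝ (Fin (N + 1))) 1,
    IsClosedEmbedding f

/-- The embeddability dimension: the smallest `N` such that the realization of `K` embeds into
the `N`-sphere (the minimum is over a non-empty set by `exists_embedsInSphere`). -/
noncomputable def embeddabilityDim {m : ℕ} (K : PreAbstractSimplicialComplex (Fin m)) : ℕ :=
  sInf {N : ℕ | EmbedsInSphere K N}

theorem isCompact_geomRealization {m : ℕ} (K : PreAbstractSimplicialComplex (Fin m)) :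
    IsCompact (geomRealization K) := by
  have h : geomRealization K =
      stdSimplex ℝ (Fin m) ∩ ⋃ τ ∈ K.faces, {x | ∀ i, i ∉ τ → x i = 0} := by
    ext x; simp [geomRealization]
  rw [h]
  refine (isCompact_stdSimplex ℝ (Fin m)).inter_right ?_
  refine (Set.toFinite K.faces).isClosed_biUnion fun τ _ => ?_
  simp only [Set.ofPred_forall]
  exact isClosed_iInter fun i => isClosed_iInter fun _ =>
    isClosed_eq (continuous_apply i) continuous_const

theorem exists_embedsInSphere {m : ℕ} (K : PreAbstractSimplicialComplex (Fin m)) :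
    ∃ N, EmbedsInSphere K N := by
  refine ⟨m, ?_⟩
  have : Fact (Module.finrank ℝ (EuclideanSpace ℝ (Fin (m + 1))) = m + 1) := ⟨by simp⟩
  have : CompactSpace (geomRealization K) :=
    isCompact_iff_compactSpace.mp (isCompact_geomRealization K)
  let v : Metric.sphere (0 : EuclideanSpace ℝ (Fin (m + 1))) 1 :=
    ⟨EuclideanSpace.single 0 1, by simp⟩
  have he := (stereographic' m v).symm.isOpenEmbedding (by simp)
  let g := (EuclideanSpace.equiv (Fin m) ℝ).symm.toHomeomorph
  have hf := he.isEmbedding.comp (g.isEmbedding.comp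
    (IsEmbedding.subtypeVal (p := (· ∈ geomRealization K))))
  exact ⟨_, hf.continuous.isClosedEmbedding hf.injective⟩

/-! ### Projections -/

/-- The face `F` of `P` is strictly preserved under the affine map `π`: it is a proper face of `P`,
its image `G = π(F)` is a proper face of `π(P)` that is combinatorially isomorphic to `F`, and the
preimage of `G` in `P` is `F`. -/
def StrictlyPreserved {n e : ℕ} (P : Set (EuclideanSpace ℝ (Fin n)))
    (π : EuclideanSpace ℝ (Fin n) →ᵃ[ℝ] EuclideanSpace ℝ (Fin e))
    (F : Set (EuclideanSpace ℝ (Fin n))) : Prop :=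
  (IsExposed ℝ P F ∧ F ≠ P) ∧
  (IsExposed ℝ (π '' P) (π '' F) ∧ π '' F ≠ π '' P) ∧
  CombIso F (π '' F) ∧
  P ∩ π ⁻¹' (π '' F) = F

/-- The projection `π` of `P` retains the `k`-skeleton: all faces of `P` of dimension at most `k`
are strictly preserved. -/
def RetainsSkeleton {n e : ℕ} (k : ℕ) (P : Set (EuclideanSpace ℝ (Fin n)))
    (π : EuclideanSpace ℝ (Fin n) →ᵃ[ℝ] EuclideanSpace ℝ (Fin e)) : Prop :=
  ∀ F, IsExposed ℝ P F → polyDim F ≤ k → StrictlyPreserved P π F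

/-!
Let `π` retain the `k`-skeleton of the realization `P`, with facet inequalities `aᵢ ≤ bᵢ` for
`i = 1, …, m`, and let `K` be the space of directions of `P` that `π` collapses, so that
`dim K ≥ dim P - e`.

Geometry. If `G` is a nonempty face of dimension at most `k`, then `0` is the only `v ∈ K` with `aᵢ v ≤ 0` for
all facets `Fᵢ ⊇ G` (`FacetInequalities.eq_zero_of_retainsSkeleton`). In other words, the
restrictions to `K` of the normals of the facets through `G` positively span the dual of `K`.

Linear algebra. Let `U ⊆ ℝ^m` be the image of `K` under `v ↦ (aᵢ v)ᵢ`. By the geometric part,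
`dim U = dim K`, and a nonzero vector of `U` has a positive coordinate off each simplex of the
coskeleton complex. Points `x`, `y` of its realization have nonnegative coordinates and vanish off
a simplex. So `x = r y + s 1 + u` with `r > 0`, `s ≥ 0` and `u ∈ U` forces `u = 0`, `s = 0` and
`x = y`, and the case `s < 0` reduces to this one by exchanging `x` and `y`; similarly
`x ∈ U + ℝ 1` is impossible. Hence the linear map `ℝ^m → ℝ^m / (U + ℝ 1)` followed by the radial
projection embeds the realization into a sphere of dimension
`m - dim U - 2 ≤ m - dim P + e - 2` (`embedsInSphere_of_submodule`). This argument takes the place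
of Gale duality: the quotient by `U` maps the realization into the boundary of a polyhedral cone.

Polytopes. All that is needed of polytope theory comes from tilting a supporting hyperplane until
it touches a further vertex (`IsPolytope.exists_tilt`). This shows that the facets, meaning the
coatoms of the face lattice, cut the polytope out of its affine hull
(`IsPolytope.exists_isCoatom_lt`), and that there are proper faces of codimension at most one, so
that the height of a nonempty face is its dimension plus one
(`IsPolytope.finrank_add_one_le_height`, `height_le_finrank_add_one`). The latter transfers the
dimensions of `P` and of its faces from the abstract lattice.
-/

/-! ### Faces of polytopes and tilting of supporting hyperplanes -/

section Faces

variable {n : ℕ} {P : Set (EuclideanSpace ℝ (Fin n))}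

/-- Faces are cut out by valid inequalities; the empty face arises from `0 ≤ 1`. -/
theorem isExposed_iff_exists_halfspace {F : Set (EuclideanSpace ℝ (Fin n))} :
    IsExposed ℝ P F ↔ ∃ (l : EuclideanSpace ℝ (Fin n) →L[ℝ] ℝ) (c : ℝ),
      (∀ x ∈ P, l x ≤ c) ∧ F = {x ∈ P | l x = c} := by
  constructor
  · intro h
    rcases F.eq_empty_or_nonempty with rfl | hF
    · exact ⟨0, 1, by simp, by simp⟩
    · obtain ⟨l, hl⟩ := h hF
      obtain ⟨x₀, hx₀⟩ := hF
      rw [hl] at hx₀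
      refine ⟨l, l x₀, hx₀.2, ?_⟩
      rw [hl]
      ext x
      exact ⟨fun hx => ⟨hx.1, le_antisymm (hx₀.2 x hx.1) (hx.2 x₀ hx₀.1)⟩,
        fun hx => ⟨hx.1, fun y hy => (hx₀.2 y hy).trans hx.2.ge⟩⟩
  · rintro ⟨l, c, hl, rfl⟩ ⟨x₀, hx₀⟩
    refine ⟨l, ?_⟩
    ext x
    exact ⟨fun hx => ⟨hx.1, fun y hy => (hl y hy).trans hx.2.ge⟩,
      fun hx => ⟨hx.1, le_antisymm (hl x hx.1) (hx₀.2.ge.trans (hx.2 x₀ hx₀.1))⟩⟩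

theorem IsPolytope.isCompact (hP : IsPolytope P) : IsCompact P := by
  obtain ⟨V, rfl⟩ := hP
  exact V.finite_toSet.isCompact_convexHull ℝ

theorem IsPolytope.convex (hP : IsPolytope P) : Convex ℝ P := by
  obtain ⟨V, rfl⟩ := hP
  exact convex_convexHull ℝ _

theorem IsPolytope.of_isExposed {F : Set (EuclideanSpace ℝ (Fin n))} (hP : IsPolytope P)
    (hF : IsExposed ℝ P F) : IsPolytope F := by
  classical
  have hc := hF.isCompact hP.isCompact
  have hv := hF.convex hP.convex
  obtain ⟨V, rfl⟩ := hP
  have hsub : F.extremePoints ℝ ⊆ V :=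
    hF.isExtreme.extremePoints_subset_extremePoints.trans extremePoints_convexHull_subset
  have hfin : (F.extremePoints ℝ).Finite := V.finite_toSet.subset hsub
  refine ⟨hfin.toFinset, ?_⟩
  rw [hfin.coe_toFinset]
  have h := closure_convexHull_extremePoints hc hv
  rwa [(hfin.isCompact_convexHull ℝ).isClosed.closure_eq, eq_comm] at h

/-- Linear inequalities hold on a polytope as soon as they hold on a set of generators. -/
theorem le_on_convexHull {V : Set (EuclideanSpace ℝ (Fin n))}
    {l : EuclideanSpace ℝ (Fin n) →L[ℝ] ℝ} {c : ℝ} (h : ∀ v ∈ V, l v ≤ c) :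
    ∀ x ∈ convexHull ℝ V, l x ≤ c :=
  convexHull_min h (convex_halfSpace_le l.toLinearMap.isLinear c)

/-- Faces of faces of a polytope are faces. -/
theorem IsPolytope.isExposed_trans {F G : Set (EuclideanSpace ℝ (Fin n))} (hP : IsPolytope P)
    (hF : IsExposed ℝ P F) (hG : IsExposed ℝ F G) : IsExposed ℝ P G := by
  obtain ⟨l, c, hl, rfl⟩ := isExposed_iff_exists_halfspace.1 hF
  obtain ⟨μ, c', hμ, rfl⟩ := isExposed_iff_exists_halfspace.1 hG
  obtain ⟨V, rfl⟩ := hP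
  -- For small `ε`, the inequality `l + ε μ ≤ c + ε c'` holds at each of the finitely many generators.
  have key : ∀ v ∈ V, ∀ᶠ ε in 𝓝[>] (0 : ℝ), l v + ε * μ v ≤ c + ε * c' := by
    intro v hv
    have hvP := subset_convexHull ℝ (V : Set (EuclideanSpace ℝ (Fin n))) (Finset.mem_coe.2 hv)
    rcases (hl v hvP).lt_or_eq with h | h
    · have h1 : Filter.Tendsto (fun ε : ℝ => l v + ε * μ v) (𝓝[>] 0) (𝓝 (l v + 0 * μ v)) :=
        tendsto_nhdsWithin_of_tendsto_nhds (Continuous.tendsto (by fun_prop) _)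
      have h2 : Filter.Tendsto (fun ε : ℝ => c + ε * c') (𝓝[>] 0) (𝓝 (c + 0 * c')) :=
        tendsto_nhdsWithin_of_tendsto_nhds (Continuous.tendsto (by fun_prop) _)
      exact (h1.eventually_lt h2 (by simpa using h)).mono fun _ h => h.le
    · filter_upwards [self_mem_nhdsWithin] with ε hε
      rw [h]
      have := mul_le_mul_of_nonneg_left (hμ v ⟨hvP, h⟩) (le_of_lt hε)
      linarith
  have key' := (Filter.eventually_all_finset V).2 key
  obtain ⟨ε, hε, hε0⟩ := (key'.and self_mem_nhdsWithin).exists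
  have hε0 : 0 < ε := hε0
  have hle : ∀ x ∈ convexHull ℝ (V : Set (EuclideanSpace ℝ (Fin n))),
      l x + ε * μ x ≤ c + ε * c' := fun x hx => by
    simpa using le_on_convexHull (l := l + ε • μ) (c := c + ε * c') (by simpa using hε) x hx
  -- Equality at `ε / 2` forces equality in both `l ≤ c` and `l + ε μ ≤ c + ε c'`.
  refine isExposed_iff_exists_halfspace.2 ⟨l + (ε / 2) • μ, c + ε / 2 * c', fun x hx => ?_, ?_⟩
  · have := hle x hx
    have := hl x hx
    simp only [add_apply, smul_apply, smul_eq_mul]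
    linarith
  · ext x
    simp only [Set.mem_ofPred_eq, add_apply, smul_apply,
      smul_eq_mul]
    refine ⟨fun ⟨⟨hx, h1⟩, h2⟩ => ⟨hx, by rw [h1, h2]⟩, fun ⟨hx, h⟩ => ?_⟩
    have h1 := hle x hx
    have h2 := hl x hx
    have h3 : l x = c := by linarith
    refine ⟨⟨hx, h3⟩, ?_⟩
    have h4 : ε * (μ x - c') = 0 := by linarith
    rcases mul_eq_zero.1 h4 with h | h <;> linarith

theorem exists_isExposed_singleton (hP : IsCompact P) (hne : P.Nonempty) :
    ∃ v ∈ P, IsExposed ℝ P {v} := by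
  obtain ⟨v, hv, hmax⟩ := hP.exists_isMaxOn hne continuous_norm.continuousOn
  -- A point of maximal norm is exposed by the inner product with itself.
  have hle : ∀ y ∈ P, inner ℝ v y ≤ ‖v‖ * ‖v‖ := fun y hy =>
    (real_inner_le_norm v y).trans (mul_le_mul_of_nonneg_left (hmax hy) (norm_nonneg v))
  refine ⟨v, hv, isExposed_iff_exists_halfspace.2 ⟨innerSL ℝ v, ‖v‖ * ‖v‖, hle, ?_⟩⟩
  ext x
  simp only [Set.mem_singleton_iff, Set.mem_ofPred_eq, innerSL_apply_apply]
  refine ⟨?_, fun ⟨hx, h⟩ => ?_⟩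
  · rintro rfl
    exact ⟨hv, real_inner_self_eq_norm_mul_norm x⟩
  · have h1 : ‖x‖ ≤ ‖v‖ := hmax hx
    have h2 : ‖x - v‖ ^ 2 ≤ 0 := by
      rw [norm_sub_sq_real, real_inner_comm, h]
      nlinarith [norm_nonneg x, norm_nonneg v]
    have h3 : ‖x - v‖ = 0 := by nlinarith [norm_nonneg (x - v)]
    exact sub_eq_zero.1 (norm_eq_zero.1 h3)

theorem sub_mem_vectorSpan {s : Set (EuclideanSpace ℝ (Fin n))} {x y : EuclideanSpace ℝ (Fin n)}
    (hx : x ∈ s) (hy : y ∈ s) : x - y ∈ vectorSpan ℝ s :=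
  vsub_mem_vectorSpan ℝ hx hy

/-- A functional that is constant on a set vanishes on its directions. -/
theorem apply_eq_zero_of_mem_vectorSpan {s : Set (EuclideanSpace ℝ (Fin n))}
    {l : EuclideanSpace ℝ (Fin n) →L[ℝ] ℝ} {c : ℝ} (h : ∀ x ∈ s, l x = c)
    {w : EuclideanSpace ℝ (Fin n)} (hw : w ∈ vectorSpan ℝ s) : l w = 0 := by
  rw [vectorSpan_def] at hw
  refine Submodule.span_induction (p := fun w _ => l w = 0) ?_ (map_zero l) ?_ ?_ hw
  · rintro _ ⟨x, hx, y, hy, rfl⟩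
    simp [h x hx, h y hy]
  · intro x y _ _ hx hy
    simp [hx, hy]
  · intro a x _ hx
    simp [hx]

/-- A face has smaller dimension than every larger subset of `P`, as its supporting functional is
constant on the face only. -/
theorem finrank_vectorSpan_lt {F G : Set (EuclideanSpace ℝ (Fin n))} (hF : IsExposed ℝ P F)
    (hne : F.Nonempty) (hFG : F ⊆ G) (hGP : G ⊆ P) (h : F ≠ G) :
    Module.finrank ℝ (vectorSpan ℝ F) < Module.finrank ℝ (vectorSpan ℝ G) := by
  obtain ⟨l, c, hl, rfl⟩ := isExposed_iff_exists_halfspace.1 hF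
  obtain ⟨x₀, hx₀⟩ := hne
  obtain ⟨q, hqG, hqF⟩ := Set.exists_of_ssubset (hFG.ssubset_of_ne h)
  refine Submodule.finrank_lt_finrank_of_lt
    (lt_of_le_of_ne (vectorSpan_mono ℝ hFG) fun heq => hqF ⟨hGP hqG, ?_⟩)
  have h1 := sub_mem_vectorSpan hqG (hFG hx₀)
  rw [← heq] at h1
  have h2 := apply_eq_zero_of_mem_vectorSpan (l := l) (c := c) (fun x hx => hx.2) h1
  rw [map_sub, hx₀.2] at h2
  linarith

/-- A supporting hyperplane `l = c` of a polytope that touches it along a face on which `μ` equals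
`b` can be tilted in the direction of `μ` until it touches a further point. -/
theorem IsPolytope.exists_tilt (hP : IsPolytope P) {l μ : EuclideanSpace ℝ (Fin n) →L[ℝ] ℝ}
    {c b : ℝ} (hl : ∀ x ∈ P, l x ≤ c) (hμ : ∀ x ∈ P, l x = c → μ x = b)
    {p : EuclideanSpace ℝ (Fin n)} (hp : p ∈ P) (hpb : b < μ p) :
    ∃ t : ℝ, (∀ x ∈ P, l x + t * μ x ≤ c + t * b) ∧
      ∃ q ∈ P, l q ≠ c ∧ l q + t * μ q = c + t * b := by
  classical
  obtain ⟨V, rfl⟩ := hP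
  have hV : ∀ v ∈ V, v ∈ convexHull ℝ (V : Set (EuclideanSpace ℝ (Fin n))) :=
    fun v hv => subset_convexHull ℝ (V : Set (EuclideanSpace ℝ (Fin n))) (Finset.mem_coe.2 hv)
  have hne : (V.filter fun v => b < μ v).Nonempty := by
    by_contra hcon
    rw [Finset.not_nonempty_iff_eq_empty, Finset.filter_eq_empty_iff] at hcon
    exact hpb.not_ge (le_on_convexHull (fun v hv => not_lt.1 (hcon hv)) p hp)
  -- Among the generators with `b < μ`, the one reached first when tilting.
  obtain ⟨q, hq, hmin⟩ := Finset.exists_min_image _ (fun v => (c - l v) / (μ v - b)) hne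
  rw [Finset.mem_filter] at hq
  have hq0 : 0 < μ q - b := sub_pos.2 hq.2
  have ht : 0 ≤ (c - l q) / (μ q - b) :=
    div_nonneg (sub_nonneg.2 (hl q (hV q hq.1))) hq0.le
  set t := (c - l q) / (μ q - b)
  refine ⟨t, fun x hx => ?_, q, hV q hq.1, fun h => hq.2.ne' (hμ q (hV q hq.1) h), ?_⟩
  · have := le_on_convexHull (V := (V : Set (EuclideanSpace ℝ (Fin n)))) (l := l + t • μ)
      (c := c + t * b) (fun v hv => ?_) x hx
    · simpa using this
    · simp only [add_apply, smul_apply, smul_eq_mul]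
      rcases le_or_gt (μ v) b with h | h
      · have := mul_le_mul_of_nonneg_left h ht
        have := hl v (hV v hv)
        linarith
      · have h1 := hmin v (Finset.mem_filter.2 ⟨hv, h⟩)
        rw [le_div_iff₀ (sub_pos.2 h)] at h1
        linarith
  · have : t * (μ q - b) = c - l q := div_mul_cancel₀ _ hq0.ne'
    linarith

/-- If the directions of a face, together with further ones, span a proper subspace `S` of the
directions of the polytope, then the face is properly contained in a face whose supporting
functional has not changed along `S`. -/
theorem IsPolytope.exists_larger_face (hP : IsPolytope P)
    {l : EuclideanSpace ℝ (Fin n) →L[ℝ] ℝ} {c : ℝ} (hl : ∀ x ∈ P, l x ≤ c)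
    {x₀ : EuclideanSpace ℝ (Fin n)} (hx₀ : x₀ ∈ P) (hlx₀ : l x₀ = c)
    {S : Submodule ℝ (EuclideanSpace ℝ (Fin n))}
    (hS : vectorSpan ℝ {x ∈ P | l x = c} ≤ S) (hPS : ¬ vectorSpan ℝ P ≤ S) :
    ∃ (l' : EuclideanSpace ℝ (Fin n) →L[ℝ] ℝ) (c' : ℝ), (∀ x ∈ P, l' x ≤ c') ∧
      {x ∈ P | l x = c} ⊂ {x ∈ P | l' x = c'} ∧ ∀ y, y - x₀ ∈ S → l' y - c' = l y - c := by
  obtain ⟨p, hp, hpS⟩ : ∃ p ∈ P, p - x₀ ∉ S := by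
    by_contra! hcon
    refine hPS ?_
    rw [vectorSpan_eq_span_vsub_set_right ℝ hx₀, Submodule.span_le]
    rintro _ ⟨p, hp, rfl⟩
    exact hcon p hp
  obtain ⟨μ, hμp, hμS⟩ : ∃ μ : EuclideanSpace ℝ (Fin n) →L[ℝ] ℝ,
      0 < μ (p - x₀) ∧ ∀ s ∈ S, μ s = 0 := by
    obtain ⟨f, hf, hfS⟩ := Submodule.exists_le_ker_of_notMem hpS
    rcases lt_or_gt_of_ne hf with h | h
    · exact ⟨-f.toContinuousLinearMap, by simpa using h, fun s hs => by
        simpa using LinearMap.mem_ker.1 (hfS hs)⟩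
    · exact ⟨f.toContinuousLinearMap, h, fun s hs => LinearMap.mem_ker.1 (hfS hs)⟩
  have hμ0 : ∀ y, y - x₀ ∈ S → μ y = μ x₀ := fun y hy => by
    have := hμS _ hy
    rw [map_sub] at this
    linarith
  have hμF : ∀ x ∈ P, l x = c → μ x = μ x₀ := fun x hx h =>
    hμ0 x (hS (sub_mem_vectorSpan (s := {x ∈ P | l x = c}) ⟨hx, h⟩ ⟨hx₀, hlx₀⟩))
  obtain ⟨t, ht, q, hq, hqc, hqt⟩ := hP.exists_tilt hl hμF hp (b := μ x₀) (by
    rw [map_sub] at hμp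
    linarith)
  refine ⟨l + t • μ, c + t * μ x₀, by simpa using ht, ?_, fun y hy => by
    simp [hμ0 y hy]⟩
  have hsub : {x ∈ P | l x = c} ⊆ {x ∈ P | (l + t • μ) x = c + t * μ x₀} := fun x hx =>
    ⟨hx.1, by simp [hx.2, hμF x hx.1 hx.2]⟩
  exact (Set.ssubset_iff_of_subset hsub).2 ⟨q, ⟨hq, by simpa using hqt⟩, fun h => hqc h.2⟩

end Faces

/-! ### Facets and the height of faces -/

section Facets

variable {n : ℕ} {P : Set (EuclideanSpace ℝ (Fin n))}

instance : OrderTop (FaceLattice P) where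
  top := ⟨P, IsExposed.refl P⟩
  le_top F := F.2.subset

theorem FaceLattice.coe_top : ((⊤ : FaceLattice P) : Set (EuclideanSpace ℝ (Fin n))) = P := rfl

/-- A polytope is cut out of its affine hull by its facets: every other point of the affine hull
violates the inequality of some facet. The facet is obtained as a face of maximal dimension
among those whose supporting hyperplane separates the point from the polytope. -/
theorem IsPolytope.exists_isCoatom_lt (hP : IsPolytope P) {y : EuclideanSpace ℝ (Fin n)}
    {x : EuclideanSpace ℝ (Fin n)} (hxP : x ∈ P) (hyx : y - x ∈ vectorSpan ℝ P) (hyP : y ∉ P) :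
    ∃ F : FaceLattice P, IsCoatom F ∧
      ∀ (a : EuclideanSpace ℝ (Fin n) →L[ℝ] ℝ) (b : ℝ), (∀ x ∈ P, a x ≤ b) →
        (F : Set (EuclideanSpace ℝ (Fin n))) = {x ∈ P | a x = b} → b < a y := by
  let T : Set ((EuclideanSpace ℝ (Fin n) →L[ℝ] ℝ) × ℝ) :=
    {q | (∀ x ∈ P, q.1 x ≤ q.2) ∧ (∃ x ∈ P, q.1 x = q.2) ∧ q.2 < q.1 y}
  have hT : T.Nonempty := by
    obtain ⟨l, s, hls, hly⟩ :=
      geometric_hahn_banach_closed_point hP.convex hP.isCompact.isClosed hyP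
    obtain ⟨x₁, hx₁, hmax⟩ := hP.isCompact.exists_isMaxOn ⟨x, hxP⟩ l.continuous.continuousOn
    exact ⟨(l, l x₁), fun z hz => hmax hz, ⟨x₁, hx₁, rfl⟩, (hls x₁ hx₁).trans hly⟩
  obtain ⟨⟨l, c⟩, ⟨hl, ⟨x₀, hx₀, hlx₀⟩, hly⟩, hmax⟩ := WellFounded.has_min
    (measure fun q : (EuclideanSpace ℝ (Fin n) →L[ℝ] ℝ) × ℝ =>
      n - Module.finrank ℝ (vectorSpan ℝ {x ∈ P | q.1 x = q.2})).wf T hT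
  dsimp only at hl hlx₀ hly
  have hF : IsExposed ℝ P {x ∈ P | l x = c} := isExposed_iff_exists_halfspace.2 ⟨l, c, hl, rfl⟩
  have hyx₀ : y - x₀ ∈ vectorSpan ℝ P := by
    have := Submodule.add_mem _ hyx (sub_mem_vectorSpan hxP hx₀)
    rwa [sub_add_sub_cancel] at this
  -- By maximality, the directions of the face together with `y - x₀` span those of `P`.
  have hspan : vectorSpan ℝ P ≤ vectorSpan ℝ {x ∈ P | l x = c} ⊔ Submodule.span ℝ {y - x₀} := by
    by_contra hcon
    obtain ⟨l', c', hl', hlt, heq⟩ := hP.exists_larger_face hl hx₀ hlx₀ le_sup_left hcon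
    have hy' := heq y (Submodule.mem_sup_right (Submodule.mem_span_singleton_self _))
    refine hmax (l', c') ⟨hl', ⟨x₀, hx₀, (hlt.1 ⟨hx₀, hlx₀⟩).2⟩, ?_⟩ ?_
    · dsimp only
      linarith
    · have h1 := finrank_vectorSpan_lt hF ⟨x₀, hx₀, hlx₀⟩ hlt.1 (fun _ h => h.1) hlt.ne
      have h2 := Submodule.finrank_le (vectorSpan ℝ {x ∈ P | l' x = c'})
      rw [finrank_euclideanSpace_fin] at h2
      change n - Module.finrank ℝ (vectorSpan ℝ {x ∈ P | l' x = c'}) <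
        n - Module.finrank ℝ (vectorSpan ℝ {x ∈ P | l x = c})
      omega
  -- So the values at `p ∈ P` and at `y` of any functional constant on the face are proportional.
  have hdecomp : ∀ p ∈ P, ∃ s : ℝ, ∀ (a : EuclideanSpace ℝ (Fin n) →L[ℝ] ℝ) (b : ℝ),
      (∀ x ∈ P, l x = c → a x = b) → a p - b = s * (a y - b) := by
    intro p hp
    obtain ⟨f, hf, g, hg, hfg⟩ := Submodule.mem_sup.1 (hspan (sub_mem_vectorSpan hp hx₀))
    obtain ⟨s, rfl⟩ := Submodule.mem_span_singleton.1 hg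
    refine ⟨s, fun a b hab => ?_⟩
    have h1 := apply_eq_zero_of_mem_vectorSpan (l := a) (c := b) (fun x hx => hab x hx.1 hx.2) hf
    have h2 := congrArg a hfg
    rw [map_add, map_smul, map_sub, map_sub, h1, hab x₀ hx₀ hlx₀, smul_eq_mul] at h2
    linarith
  have hviol : ∀ (a : EuclideanSpace ℝ (Fin n) →L[ℝ] ℝ) (b : ℝ), (∀ x ∈ P, a x ≤ b) →
      (∀ x ∈ P, l x = c → a x = b) → (∃ p ∈ P, a p ≠ b) → b < a y := by
    rintro a b hab hFa ⟨p, hp, hpb⟩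
    obtain ⟨s, hs⟩ := hdecomp p hp
    have h1 := hs l c fun _ _ h => h
    have h2 := hs a b hFa
    have h3 : a p < b := lt_of_le_of_ne (hab p hp) hpb
    have h4 : l p < c := lt_of_le_of_ne (hl p hp) fun h => hpb (hFa p hp h)
    have hs0 : s < 0 := by
      by_contra hcon
      nlinarith [mul_nonneg (not_lt.1 hcon) (sub_pos.2 hly).le]
    by_contra hcon
    nlinarith [mul_nonneg_of_nonpos_of_nonpos hs0.le (sub_nonpos.2 (not_lt.1 hcon))]
  have hne : ∃ p ∈ P, l p ≠ c := by
    by_contra! hcon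
    have := apply_eq_zero_of_mem_vectorSpan hcon hyx₀
    rw [map_sub, hlx₀] at this
    linarith
  refine ⟨⟨_, hF⟩, ⟨fun h => ?_, fun G hG => ?_⟩, fun a b hab hFa => hviol a b hab ?_ ?_⟩
  · obtain ⟨p, hp, hpc⟩ := hne
    have h1 : {x ∈ P | l x = c} = P := congrArg Subtype.val h
    rw [← h1] at hp
    exact hpc hp.2
  · obtain ⟨a, b, hab, hGa⟩ := isExposed_iff_exists_halfspace.1 G.2
    have hFG : {x ∈ P | l x = c} ⊂ (G : Set (EuclideanSpace ℝ (Fin n))) := hG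
    rw [hGa] at hFG
    have hFa : ∀ x ∈ P, l x = c → a x = b := fun x hx h => (hFG.1 ⟨hx, h⟩).2
    obtain ⟨q, ⟨hq, hqb⟩, hqF⟩ := Set.exists_of_ssubset hFG
    obtain ⟨s, hs⟩ := hdecomp q hq
    refine Subtype.ext (hGa.trans ?_)
    rw [FaceLattice.coe_top]
    refine Set.Subset.antisymm (fun _ h => h.1) fun p hp => ⟨hp, ?_⟩
    by_contra hpb
    have h1 := hviol a b hab hFa ⟨p, hp, hpb⟩
    have h2 := hs a b hFa
    rw [hqb, sub_self, eq_comm, mul_eq_zero] at h2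
    rcases h2 with h2 | h2
    · have h3 := hs l c fun _ _ h => h
      rw [h2, zero_mul] at h3
      exact hqF ⟨hq, by linarith⟩
    · linarith
  · intro x hx h
    have : x ∈ {x ∈ P | a x = b} := hFa ▸ ⟨hx, h⟩
    exact this.2
  · obtain ⟨p, hp, hpc⟩ := hne
    refine ⟨p, hp, fun h => hpc ?_⟩
    have : p ∈ {x ∈ P | l x = c} := by
      have h1 : {x ∈ P | l x = c} = {x ∈ P | a x = b} := hFa
      rw [h1]
      exact ⟨hp, h⟩
    exact this.2

/-- `FacetInequalities P F a b` says that `F i`, for `i` in `ι`, are all the facets of `P`, and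
that `F i` is the set where the inequality `a i ≤ b i`, valid on `P`, is an equality. -/
structure FacetInequalities {ι : Type*} (P : Set (EuclideanSpace ℝ (Fin n)))
    (F : ι → Set (EuclideanSpace ℝ (Fin n))) (a : ι → EuclideanSpace ℝ (Fin n) →L[ℝ] ℝ)
    (b : ι → ℝ) : Prop where
  le : ∀ i, ∀ x ∈ P, a i x ≤ b i
  eq : ∀ i, F i = {x ∈ P | a i x = b i}
  surj : ∀ G : FaceLattice P, IsCoatom G → ∃ i, (G : Set (EuclideanSpace ℝ (Fin n))) = F i

variable {ι : Type*} {F : ι → Set (EuclideanSpace ℝ (Fin n))}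
  {a : ι → EuclideanSpace ℝ (Fin n) →L[ℝ] ℝ} {b : ι → ℝ}

theorem FacetInequalities.isExposed (h : FacetInequalities P F a b) (i : ι) :
    IsExposed ℝ P (F i) :=
  isExposed_iff_exists_halfspace.2 ⟨a i, b i, h.le i, h.eq i⟩

theorem FacetInequalities.apply_eq (h : FacetInequalities P F a b) {i : ι}
    {x : EuclideanSpace ℝ (Fin n)} (hx : x ∈ F i) : a i x = b i := by
  rw [h.eq i] at hx
  exact hx.2

/-- A direction of `P` along which one cannot move from the point `x` within `P` is excluded by a
facet through `x`. -/
theorem FacetInequalities.exists_pos [Finite ι] (h : FacetInequalities P F a b)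
    (hP : IsPolytope P) {x w : EuclideanSpace ℝ (Fin n)} (hx : x ∈ P) (hw : w ∈ vectorSpan ℝ P)
    (hout : ∀ ε : ℝ, 0 < ε → x + ε • w ∉ P) : ∃ i, x ∈ F i ∧ 0 < a i w := by
  by_contra! hcon
  -- Near `x` only the facets through `x` matter, and `w` violates none of their inequalities.
  have key : ∀ i, ∀ᶠ ε in 𝓝[>] (0 : ℝ), a i x + ε * a i w ≤ b i := by
    intro i
    rcases (h.le i x hx).lt_or_eq with h1 | h1
    · have h2 : Filter.Tendsto (fun ε : ℝ => a i x + ε * a i w) (𝓝[>] 0) (𝓝 (a i x + 0 * a i w)) :=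
        tendsto_nhdsWithin_of_tendsto_nhds (Continuous.tendsto (by fun_prop) _)
      exact (h2.eventually_lt_const (by simpa using h1)).mono fun _ h => h.le
    · filter_upwards [self_mem_nhdsWithin] with ε hε
      have h2 := hcon i (by rw [h.eq i]; exact ⟨hx, h1⟩)
      have := mul_nonpos_of_nonneg_of_nonpos (le_of_lt hε) h2
      linarith
  obtain ⟨ε, hε, hε0⟩ := ((Filter.eventually_all.2 key).and self_mem_nhdsWithin).exists
  obtain ⟨G, hG, hGy⟩ := hP.exists_isCoatom_lt (y := x + ε • w) hx
    (by simpa using Submodule.smul_mem _ ε hw) (hout ε hε0)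
  obtain ⟨i, hi⟩ := h.surj G hG
  have h1 := hGy (a i) (b i) (h.le i) (hi.trans (h.eq i))
  rw [map_add, map_smul, smul_eq_mul] at h1
  exact h1.not_ge (hε i)

/-- Every polytope of positive dimension has a nonempty proper face of codimension at most one. -/
theorem IsPolytope.exists_facet (hP : IsPolytope P)
    (hdim : 0 < Module.finrank ℝ (vectorSpan ℝ P)) :
    ∃ G, IsExposed ℝ P G ∧ G.Nonempty ∧ G ≠ P ∧
      Module.finrank ℝ (vectorSpan ℝ P) ≤ Module.finrank ℝ (vectorSpan ℝ G) + 1 := by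
  have hne : P.Nonempty := by
    by_contra hcon
    rw [Set.not_nonempty_iff_eq_empty.1 hcon, vectorSpan_empty, finrank_bot] at hdim
    exact hdim.ne rfl
  let T : Set (Set (EuclideanSpace ℝ (Fin n))) := {G | IsExposed ℝ P G ∧ G.Nonempty ∧ G ≠ P}
  have hT : T.Nonempty := by
    obtain ⟨v, -, hv⟩ := exists_isExposed_singleton hP.isCompact hne
    refine ⟨{v}, hv, Set.singleton_nonempty v, ?_⟩
    rintro rfl
    rw [vectorSpan_singleton, finrank_bot] at hdim
    exact hdim.ne rfl
  obtain ⟨G, ⟨hG, hGne, hGP⟩, hmax⟩ := WellFounded.has_min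
    (measure fun G : Set (EuclideanSpace ℝ (Fin n)) =>
      n - Module.finrank ℝ (vectorSpan ℝ G)).wf T hT
  refine ⟨G, hG, hGne, hGP, ?_⟩
  obtain ⟨p, hp, hpG⟩ := Set.exists_of_ssubset (hG.subset.ssubset_of_ne hGP)
  obtain ⟨l, c, hl, rfl⟩ := isExposed_iff_exists_halfspace.1 hG
  obtain ⟨x₀, hx₀, hlx₀⟩ := hGne
  have hspan : vectorSpan ℝ P ≤ vectorSpan ℝ {x ∈ P | l x = c} ⊔ Submodule.span ℝ {p - x₀} := by
    by_contra hcon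
    obtain ⟨l', c', hl', hlt, heq⟩ := hP.exists_larger_face hl hx₀ hlx₀ le_sup_left hcon
    have hp' := heq p (Submodule.mem_sup_right (Submodule.mem_span_singleton_self _))
    have hlp : l p ≠ c := fun h => hpG ⟨hp, h⟩
    refine hmax {x ∈ P | l' x = c'} ⟨isExposed_iff_exists_halfspace.2 ⟨l', c', hl', rfl⟩,
      ⟨x₀, hlt.1 ⟨hx₀, hlx₀⟩⟩, fun h => ?_⟩ ?_
    · have h1 := hp
      rw [← h] at h1
      rw [h1.2, sub_self] at hp'
      exact hlp (by linarith)
    · have h1 := finrank_vectorSpan_lt hG ⟨x₀, hx₀, hlx₀⟩ hlt.1 (fun _ h => h.1) hlt.ne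
      have h2 := Submodule.finrank_le (vectorSpan ℝ {x ∈ P | l' x = c'})
      rw [finrank_euclideanSpace_fin] at h2
      change n - Module.finrank ℝ (vectorSpan ℝ {x ∈ P | l' x = c'}) <
        n - Module.finrank ℝ (vectorSpan ℝ {x ∈ P | l x = c})
      omega
  refine (Submodule.finrank_mono hspan).trans ((Submodule.finrank_add_le_finrank_add_finrank _ _).trans
    (Nat.add_le_add_left ((finrank_span_le_card _).trans ?_) _))
  simp

/-- By descending through proper faces of codimension at most one, a face of dimension `j` is the
top of a chain of `j + 2` faces that starts at the empty face. -/
theorem IsPolytope.finrank_add_one_le_height (hP : IsPolytope P) (F : FaceLattice P)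
    (hF : (F : Set (EuclideanSpace ℝ (Fin n))).Nonempty) :
    ((Module.finrank ℝ (vectorSpan ℝ (F : Set (EuclideanSpace ℝ (Fin n)))) + 1 : ℕ) : ℕ∞)
      ≤ Order.height F := by
  induction hj : Module.finrank ℝ (vectorSpan ℝ (F : Set (EuclideanSpace ℝ (Fin n))))
    using Nat.strong_induction_on generalizing F with
  | _ j ih =>
    rcases Nat.eq_zero_or_pos j with rfl | hpos
    · have h1 : (⟨∅, isExposed_empty⟩ : FaceLattice P) < F :=
        Set.empty_ssubset.2 hF
      simpa using le_add_self.trans (Order.height_add_one_le h1)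
    · obtain ⟨G, hG, hGne, hGF, hdim⟩ := (hP.of_isExposed F.2).exists_facet (hj ▸ hpos)
      have hlt := finrank_vectorSpan_lt hG hGne hG.subset le_rfl hGF
      let G' : FaceLattice P := ⟨G, hP.isExposed_trans F.2 hG⟩
      have h1 : G' < F := hG.subset.ssubset_of_ne hGF
      have h2 := ih _ (hj ▸ hlt) G' hGne rfl
      refine le_trans ?_ (Order.height_add_one_le h1)
      refine le_trans ?_ (add_le_add_left h2 1)
      rw [hj] at hdim
      exact_mod_cast Nat.add_le_add_right hdim 1

theorem height_le_finrank_add_one (F : FaceLattice P) :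
    Order.height F ≤
      ((Module.finrank ℝ (vectorSpan ℝ (F : Set (EuclideanSpace ℝ (Fin n)))) + 1 : ℕ) : ℕ∞) := by
  classical
  -- The rank function of the face lattice: `0` at the empty face, else the dimension plus one.
  let r : FaceLattice P → ℕ := fun F => if (F : Set (EuclideanSpace ℝ (Fin n))) = ∅ then 0 else
    Module.finrank ℝ (vectorSpan ℝ (F : Set (EuclideanSpace ℝ (Fin n)))) + 1
  have hr : StrictMono r := by
    intro F G hFG
    have hss : (F : Set (EuclideanSpace ℝ (Fin n))) ⊂ G := hFG
    have hG : (G : Set (EuclideanSpace ℝ (Fin n))) ≠ ∅ := fun h => by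
      rw [h] at hss
      exact hss.2 (Set.empty_subset _)
    by_cases hF : (F : Set (EuclideanSpace ℝ (Fin n))) = ∅
    · simp [r, hF, hG]
    · have := finrank_vectorSpan_lt F.2 (Set.nonempty_iff_ne_empty.2 hF) hss.1 G.2.subset hss.ne
      simpa [r, hF, hG] using this
  refine (Order.height_le_height_apply_of_strictMono r hr F).trans ?_
  rw [Order.height_nat]
  dsimp only [r]
  split_ifs <;> simp

end Facets

/-! ### Projections that retain a skeleton -/

section Projection

variable {n e : ℕ} {P : Set (EuclideanSpace ℝ (Fin n))}
  {π : EuclideanSpace ℝ (Fin n) →ᵃ[ℝ] EuclideanSpace ℝ (Fin e)}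
  {ι : Type*} {F : ι → Set (EuclideanSpace ℝ (Fin n))}
  {a : ι → EuclideanSpace ℝ (Fin n) →L[ℝ] ℝ} {b : ι → ℝ}

/-- A nonempty polytope has a point lying in no face other than those that contain the polytope;
the barycenter of a set of generators is one. -/
theorem IsPolytope.exists_mem_forall_le (hP : IsPolytope P) (hne : P.Nonempty) :
    ∃ x ∈ P, ∀ (l : EuclideanSpace ℝ (Fin n) →L[ℝ] ℝ) (c : ℝ), (∀ y ∈ P, l y ≤ c) → l x = c →
      ∀ y ∈ P, l y = c := by
  obtain ⟨V, rfl⟩ := hP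
  have hV : V.Nonempty := by simpa using hne
  have hcard : (0 : ℝ) < V.card := by exact_mod_cast hV.card_pos
  refine ⟨V.centerMass (fun _ => (1 : ℝ)) id,
    V.centerMass_mem_convexHull (fun _ _ => zero_le_one) (by simpa using hcard)
      fun v hv => hv, fun l c hl hx => ?_⟩
  have hVc : ∀ v ∈ V, l v ≤ c := fun v hv =>
    hl v (subset_convexHull ℝ (V : Set (EuclideanSpace ℝ (Fin n))) (Finset.mem_coe.2 hv))
  have hsum : ∑ v ∈ V, l v = ∑ v ∈ V, c := by
    simp only [Finset.centerMass, Finset.sum_const, nsmul_eq_mul, mul_one, one_smul, id, map_smul,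
      map_sum, smul_eq_mul] at hx
    rw [inv_mul_eq_iff_eq_mul₀ hcard.ne'] at hx
    simpa using hx
  have hVeq : ∀ v ∈ V, l v = c := (Finset.sum_eq_sum_iff_of_le hVc).1 hsum
  refine fun y hy => le_antisymm (hl y hy) ?_
  have := le_on_convexHull (V := (V : Set (EuclideanSpace ℝ (Fin n)))) (l := -l) (c := -c)
    (fun v hv => by simp [hVeq v hv]) y hy
  simpa using this

theorem polyDim_of_nonempty {S : Set (EuclideanSpace ℝ (Fin n))} (hS : S.Nonempty) :
    polyDim S = Module.finrank ℝ (vectorSpan ℝ S) := by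
  rw [polyDim, if_neg hS.ne_empty]

theorem polyDim_mono {S T : Set (EuclideanSpace ℝ (Fin n))} (h : S ⊆ T) :
    polyDim S ≤ polyDim T := by
  rcases S.eq_empty_or_nonempty with rfl | hS
  · rw [polyDim, if_pos rfl, polyDim]
    split_ifs <;> omega
  · rw [polyDim_of_nonempty hS, polyDim_of_nonempty (hS.mono h)]
    exact_mod_cast Submodule.finrank_mono (vectorSpan_mono ℝ h)

/-- A proper face of a polytope lies in a facet. -/
theorem FacetInequalities.exists_subset [Finite ι] (h : FacetInequalities P F a b)
    (hP : IsPolytope P) {G : Set (EuclideanSpace ℝ (Fin n))} (hG : IsExposed ℝ P G)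
    (hGne : G.Nonempty) (hGP : G ≠ P) : ∃ i, G ⊆ F i := by
  obtain ⟨x, hxG, hx⟩ := (hP.of_isExposed hG).exists_mem_forall_le hGne
  obtain ⟨p, hp, hpG⟩ := Set.exists_of_ssubset (hG.subset.ssubset_of_ne hGP)
  have hxP := hG.subset hxG
  obtain ⟨l, c, hl, hGl⟩ := isExposed_iff_exists_halfspace.1 hG
  have hlx : l x = c := by
    rw [hGl] at hxG
    exact hxG.2
  obtain ⟨i, hi, -⟩ := h.exists_pos hP hxP (sub_mem_vectorSpan hxP hp) fun ε hε hmem => by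
    -- Moving from `x` away from `p` leaves `P` through the supporting hyperplane of `G`.
    have h1 := hl _ hmem
    rw [map_add, map_smul, map_sub, smul_eq_mul, hlx] at h1
    have h2 : l p < c := lt_of_le_of_ne (hl p hp) fun h => hpG (by rw [hGl]; exact ⟨hp, h⟩)
    nlinarith [mul_pos hε (sub_pos.2 h2)]
  refine ⟨i, fun y hy => ?_⟩
  rw [h.eq i]
  exact ⟨hG.subset hy,
    hx (a i) (b i) (fun z hz => h.le i z (hG.subset hz)) (h.apply_eq hi) y hy⟩

/-- The normals of the facets through a face `G` in the retained skeleton positively span the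
dual of the space of directions of `P` collapsed by `π`. Otherwise one can run, inside the fibre of
`π`, from a relative interior point `x` of `G` to a last point `y` of `P`, which lies in `G` and
in a facet not containing `G`; the face where this facet meets `G` is then not the full preimage of
its image, as that preimage contains `x`. -/
theorem FacetInequalities.eq_zero_of_retainsSkeleton [Finite ι] (h : FacetInequalities P F a b)
    (hP : IsPolytope P) {k : ℕ} (hret : RetainsSkeleton k P π)
    {G : Set (EuclideanSpace ℝ (Fin n))} (hG : IsExposed ℝ P G) (hGne : G.Nonempty)
    (hGk : polyDim G ≤ k) {v : EuclideanSpace ℝ (Fin n)} (hv : v ∈ vectorSpan ℝ P)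
    (hπv : π.linear v = 0) (hav : ∀ i, G ⊆ F i → a i v ≤ 0) : v = 0 := by
  by_contra hv0
  obtain ⟨x, hxG, hx⟩ := (hP.of_isExposed hG).exists_mem_forall_le hGne
  have hxP := hG.subset hxG
  have hπ : ∀ t : ℝ, π (x + t • v) = π x := fun t => by
    have := π.map_vadd x (t • v)
    rw [map_smul, hπv, smul_zero, zero_vadd] at this
    rwa [add_comm]
  have hemb : IsClosedEmbedding fun t : ℝ => x + t • v :=
    (Homeomorph.addLeft x).isClosedEmbedding.comp (isClosedEmbedding_smul_left hv0)
  obtain ⟨t, htP, htmax⟩ := (hemb.isCompact_preimage hP.isCompact).exists_isMaxOn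
    ⟨0, by simpa using hxP⟩ continuous_id.continuousOn
  have hyP : x + t • v ∈ P := htP
  have hyG : x + t • v ∈ G := by
    rw [← (hret G hG hGk).2.2.2]
    exact ⟨hyP, x, hxG, (hπ t).symm⟩
  obtain ⟨i, hi, hiv⟩ := h.exists_pos hP hyP hv fun ε hε hmem => by
    rw [add_assoc, ← add_smul] at hmem
    have : t + ε ≤ t := htmax hmem
    linarith
  have hxi : x ∉ F i := fun hxi => by
    refine (hav i fun y hy => ?_).not_gt hiv
    rw [h.eq i]
    exact ⟨hG.subset hy,
      hx (a i) (b i) (fun z hz => h.le i z (hG.subset hz)) (h.apply_eq hxi) y hy⟩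
  have hGi := (hret (G ∩ F i) (hG.inter (h.isExposed i))
    ((polyDim_mono Set.inter_subset_left).trans hGk)).2.2.2
  have hmem : x ∈ P ∩ π ⁻¹' (π '' (G ∩ F i)) := ⟨hxP, _, ⟨hyG, hi⟩, hπ t⟩
  rw [hGi] at hmem
  exact hxi hmem.2

/-- The facets of a polytope have no common point. -/
theorem FacetInequalities.exists_notMem [Finite ι] (h : FacetInequalities P F a b)
    (hP : IsPolytope P) (hdim : 0 < Module.finrank ℝ (vectorSpan ℝ P))
    {v : EuclideanSpace ℝ (Fin n)} (hv : v ∈ P) : ∃ i, v ∉ F i := by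
  by_contra! hall
  -- From a point `w` of `P` at maximal distance to `v`, one cannot move further away from `v`.
  obtain ⟨w, hw, hmax⟩ := hP.isCompact.exists_isMaxOn ⟨v, hv⟩
    (f := fun y => ‖y - v‖) (by fun_prop)
  have hwv : 0 < ‖w - v‖ := by
    by_contra hcon
    have hP' : P ⊆ {v} := fun y hy => by
      have : ‖y - v‖ ≤ ‖w - v‖ := hmax hy
      exact sub_eq_zero.1 (norm_le_zero_iff.1 (this.trans (not_lt.1 hcon)))
    have := Submodule.finrank_mono (vectorSpan_mono ℝ hP')
    rw [vectorSpan_singleton, finrank_bot] at this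
    omega
  obtain ⟨i, hi, hpos⟩ := h.exists_pos hP hw (sub_mem_vectorSpan hw hv) fun ε hε hmem => by
    have h1 : ‖w + ε • (w - v) - v‖ ≤ ‖w - v‖ := hmax hmem
    have h2 : w + ε • (w - v) - v = (1 + ε) • (w - v) := by module
    rw [h2, norm_smul, Real.norm_of_nonneg (by linarith)] at h1
    nlinarith
  rw [map_sub, h.apply_eq hi, h.apply_eq (hall i), sub_self] at hpos
  exact hpos.false

end Projection

/-! ### Embedding a complex into a sphere -/

section Embedding

variable {m : ℕ} {U : Submodule ℝ (Fin m → ℝ)}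

/-- If `x = u + s 1` with `u ∈ U`, then `u ≤ 0` on `J` in case `s ≥ 0`, and `-u ≤ 0` everywhere in case
`s < 0`. -/
theorem notMem_sup_span_one {J : Set (Fin m)} (hJ : J.Nonempty)
    (hU : ∀ u ∈ U, (∀ i ∈ J, u i ≤ 0) → u = 0) {x : Fin m → ℝ} (hx : ∀ i, 0 ≤ x i) (hx0 : x ≠ 0)
    (hxJ : ∀ i ∈ J, x i = 0) : x ∉ U ⊔ Submodule.span ℝ {1} := by
  intro hmem
  obtain ⟨u, hu, y, hy, hxy⟩ := Submodule.mem_sup.1 hmem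
  obtain ⟨s, rfl⟩ := Submodule.mem_span_singleton.1 hy
  obtain ⟨j, hj⟩ := hJ
  have hi : ∀ i, x i = u i + s := fun i => by simp [← hxy]
  rcases le_or_gt 0 s with hs | hs
  · have hu0 := hU u hu fun i hiJ => by
      have := hi i
      rw [hxJ i hiJ] at this
      linarith
    have hs0 : s = 0 := by
      have := hi j
      rw [hxJ j hj, hu0] at this
      simpa using this.symm
    exact hx0 (by rw [← hxy, hu0, hs0]; simp)
  · have hu0 := hU (-u) (U.neg_mem hu) fun i _ => by
      have := hi i
      have := hx i
      simp only [Pi.neg_apply]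
      linarith
    have := hi j
    rw [hxJ j hj, neg_eq_zero.1 hu0, Pi.zero_apply, zero_add] at this
    exact hs.ne this.symm

/-- Points of the standard simplex that vanish on sets `J` and `J'`, respectively, where every nonzero
vector of `U` has a positive coordinate, lie on different rays modulo `U` and the vector `1`. -/
theorem eq_of_sub_smul_mem_sup {J J' : Set (Fin m)} (hJ : J.Nonempty) (hJ' : J'.Nonempty)
    (hU : ∀ u ∈ U, (∀ i ∈ J, u i ≤ 0) → u = 0) (hU' : ∀ u ∈ U, (∀ i ∈ J', u i ≤ 0) → u = 0)
    {x y : Fin m → ℝ} (hx : x ∈ stdSimplex ℝ (Fin m)) (hy : y ∈ stdSimplex ℝ (Fin m))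
    (hxJ : ∀ i ∈ J, x i = 0) (hyJ : ∀ i ∈ J', y i = 0) {r : ℝ} (hr : 0 < r)
    (h : x - r • y ∈ U ⊔ Submodule.span ℝ {1}) : x = y := by
  -- The situation is symmetric in `x` and `y`, so the coefficient of `1` may be taken nonnegative.
  have main : ∀ {J : Set (Fin m)} {x y : Fin m → ℝ} {r s : ℝ} {u : Fin m → ℝ}, J.Nonempty →
      (∀ u ∈ U, (∀ i ∈ J, u i ≤ 0) → u = 0) → x ∈ stdSimplex ℝ (Fin m) → y ∈ stdSimplex ℝ (Fin m) →
      (∀ i ∈ J, x i = 0) → 0 < r → 0 ≤ s → u ∈ U → (∀ i, x i = r * y i + s + u i) → x = y := by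
    intro J x y r s u hJ hU hx hy hxJ hr hs hu hi
    have hu0 := hU u hu fun i hiJ => by
      have h1 := hi i
      have := mul_nonneg hr.le (hy.1 i)
      rw [hxJ i hiJ] at h1
      linarith
    obtain ⟨j, hj⟩ := hJ
    have hs0 : s = 0 := by
      have h1 := hi j
      have := mul_nonneg hr.le (hy.1 j)
      rw [hxJ j hj, hu0, Pi.zero_apply] at h1
      linarith
    have hxy : ∀ i, x i = r * y i := fun i => by simpa [hu0, hs0] using hi i
    have hr1 : r = 1 := by
      have h1 := hx.2
      simp_rw [hxy, ← Finset.mul_sum, hy.2, mul_one] at h1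
      exact h1
    ext i
    rw [hxy, hr1, one_mul]
  obtain ⟨u, hu, z, hz, hxy⟩ := Submodule.mem_sup.1 h
  obtain ⟨s, rfl⟩ := Submodule.mem_span_singleton.1 hz
  have hi : ∀ i, u i + s = x i - r * y i := fun i => by simpa using congrFun hxy i
  rcases le_total 0 s with hs | hs
  · exact main hJ hU hx hy hxJ hr hs hu fun i => by linarith [hi i]
  · refine (main (r := r⁻¹) (s := r⁻¹ * -s) (u := r⁻¹ • -u) hJ' hU' hy hx hyJ (inv_pos.2 hr)
      (mul_nonneg (inv_pos.2 hr).le (neg_nonneg.2 hs)) (U.smul_mem _ (U.neg_mem hu))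
      fun i => ?_).symm
    simp only [Pi.smul_apply, Pi.neg_apply, smul_eq_mul]
    rw [← mul_add, ← mul_add, eq_inv_mul_iff_mul_eq₀ hr.ne']
    linarith [hi i]

/-- The embedding behind the theorem: if every nonzero vector of `U` has a positive coordinate off
each simplex of `K`, then the composition of `ℝ^m → ℝ^m / (U + ℝ·1)` with the radial projection
to the unit sphere embeds the realization of `K`. -/
theorem embedsInSphere_of_submodule {K : PreAbstractSimplicialComplex (Fin m)} {N : ℕ}
    (hN : Module.finrank ℝ ((Fin m → ℝ) ⧸ (U ⊔ Submodule.span ℝ {1})) = N + 1)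
    (hne : ∀ τ ∈ K.faces, ∃ i, i ∉ τ)
    (hU : ∀ τ ∈ K.faces, ∀ u ∈ U, (∀ i, i ∉ τ → u i ≤ 0) → u = 0) : EmbedsInSphere K N := by
  set S := U ⊔ Submodule.span ℝ {(1 : Fin m → ℝ)} with hS
  have : CompactSpace (geomRealization K) :=
    isCompact_iff_compactSpace.mp (isCompact_geomRealization K)
  let φ : ((Fin m → ℝ) ⧸ S) ≃ₗ[ℝ] EuclideanSpace ℝ (Fin (N + 1)) :=
    LinearEquiv.ofFinrankEq _ _ (by rw [hN, finrank_euclideanSpace_fin])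
  let q : (Fin m → ℝ) →ₗ[ℝ] EuclideanSpace ℝ (Fin (N + 1)) := φ.toLinearMap ∘ₗ S.mkQ
  have hq : ∀ x, q x = 0 ↔ x ∈ S := fun x => by simp [q]
  have hqc : Continuous q := q.continuous_of_finiteDimensional
  have hq0 : ∀ x : geomRealization K, q x ≠ 0 := by
    rintro ⟨x, hx, τ, hτ, hxτ⟩ h0
    refine notMem_sup_span_one (J := {i | i ∉ τ}) (hne τ hτ) (hU τ hτ) hx.1 ?_ hxτ ((hq x).1 h0)
    rintro rfl
    simpa using hx.2
  let f : geomRealization K → Metric.sphere (0 : EuclideanSpace ℝ (Fin (N + 1))) 1 := fun x =>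
    ⟨‖q x‖⁻¹ • q x, by simp [norm_smul, inv_mul_cancel₀ (norm_ne_zero_iff.2 (hq0 x))]⟩
  have hf : Continuous f := by
    refine Continuous.subtype_mk ?_ _
    have hc : Continuous fun x : geomRealization K => q x := hqc.comp continuous_subtype_val
    exact (hc.norm.inv₀ fun x => norm_ne_zero_iff.2 (hq0 x)).smul hc
  refine ⟨f, hf.isClosedEmbedding ?_⟩
  intro x y hxy
  have hxy' : ‖q x‖⁻¹ • q x = ‖q y‖⁻¹ • q y := congrArg Subtype.val hxy
  have hx0 := norm_pos_iff.2 (hq0 x)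
  have hy0 := norm_pos_iff.2 (hq0 y)
  have h1 : q x = (‖q x‖ * ‖q y‖⁻¹) • q y := by
    rw [mul_smul, ← hxy', smul_inv_smul₀ hx0.ne']
  have h2 : (x : Fin m → ℝ) - (‖q x‖ * ‖q y‖⁻¹) • (y : Fin m → ℝ) ∈ S := by
    rw [← hq, map_sub, map_smul, ← h1, sub_self]
  obtain ⟨x, hx, τ, hτ, hxτ⟩ := x
  obtain ⟨y, hy, σ, hσ, hyσ⟩ := y
  exact Subtype.ext (eq_of_sub_smul_mem_sup (J := {i | i ∉ τ}) (J' := {i | i ∉ σ}) (hne τ hτ)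
    (hne σ hσ) (hU τ hτ) (hU σ hσ) hx hy hxτ hyσ (mul_pos hx0 (inv_pos.2 hy0)) h2)

end Embedding

/-! ### The projection obstruction -/

theorem mainTheorem7 {L : Type*} [PartialOrder L] [OrderTop L] (d m k e : ℕ)
    (hL : IsCombinatorialType L d) (facet : Fin m ≃ {F : L // IsCoatom F}) (hk : k < d)
    (he : (e : ℤ) < (embeddabilityDim (coskeleton facet k) : ℤ) + d - m + 2) :
    ¬ ∃ (n : ℕ) (P : Set (EuclideanSpace ℝ (Fin n)))
        (π : EuclideanSpace ℝ (Fin n) →ᵃ[ℝ] EuclideanSpace ℝ (Fin e)),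
        IsRealization L P ∧ RetainsSkeleton k P π := by
  rintro ⟨n, P, π, ⟨hP, ⟨φ⟩⟩, hret⟩
  obtain ⟨n₀, P₀, ⟨hP₀, ⟨φ₀⟩⟩, hd⟩ := hL
  -- The dimension is a combinatorial invariant, so `P` has dimension at least `d`.
  have hP₀ne : P₀.Nonempty := by
    by_contra hcon
    rw [polyDim, if_pos (Set.not_nonempty_iff_eq_empty.1 hcon)] at hd
    omega
  rw [polyDim_of_nonempty hP₀ne] at hd
  have hd' : Module.finrank ℝ (vectorSpan ℝ P₀) = d := by exact_mod_cast hd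
  have hheight : ((d + 1 : ℕ) : ℕ∞) ≤ Order.height (⊤ : L) := by
    have h1 := hP₀.finrank_add_one_le_height ⊤ hP₀ne
    rwa [FaceLattice.coe_top, hd', ← map_top φ₀, Order.height_orderIso] at h1
  have hdim : d ≤ Module.finrank ℝ (vectorSpan ℝ P) := by
    have h1 := height_le_finrank_add_one (⊤ : FaceLattice P)
    rw [FaceLattice.coe_top, ← map_top φ, Order.height_orderIso] at h1
    have h2 := hheight.trans h1
    rw [Nat.cast_le] at h2
    omega
  have hPne : P.Nonempty := by
    by_contra hcon
    rw [Set.not_nonempty_iff_eq_empty.1 hcon, vectorSpan_empty, finrank_bot] at hdim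
    omega
  let F : Fin m → Set (EuclideanSpace ℝ (Fin n)) := fun i => φ (facet i)
  choose a b hab hFab using fun i => isExposed_iff_exists_halfspace.1 (φ (facet i)).2
  have hF : FacetInequalities P F a b := by
    refine ⟨hab, hFab, fun G hG => ?_⟩
    have hG' : IsCoatom (φ.symm G) := (φ.symm.isCoatom_iff G).2 hG
    exact ⟨facet.symm ⟨_, hG'⟩, by simp [F]⟩
  let K : Submodule ℝ (vectorSpan ℝ P) := LinearMap.ker (π.linear.domRestrict (vectorSpan ℝ P))
  let A : K →ₗ[ℝ] (Fin m → ℝ) :=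
    (LinearMap.pi fun i => (a i).toLinearMap) ∘ₗ (vectorSpan ℝ P).subtype ∘ₗ K.subtype
  have hA : ∀ v i, A v i = a i v := fun _ _ => rfl
  -- Every nonzero vector in the range of `A` is positive on a facet through a given retained face.
  have hpos : ∀ G, IsExposed ℝ P G → G.Nonempty → polyDim G ≤ k → ∀ v,
      (∀ i, G ⊆ F i → A v i ≤ 0) → v = 0 := fun G hG hGne hGk v hv =>
    Subtype.ext (Subtype.ext
      (hF.eq_zero_of_retainsSkeleton hP hret hG hGne hGk v.1.2 v.2 hv))
  have hposU : ∀ G, IsExposed ℝ P G → G.Nonempty → polyDim G ≤ k → ∀ u ∈ LinearMap.range A,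
      (∀ i, G ⊆ F i → u i ≤ 0) → u = 0 := by
    rintro G hG hGne hGk _ ⟨v, rfl⟩ hv
    rw [hpos G hG hGne hGk v hv, map_zero]
  obtain ⟨x, hxP, hx⟩ := exists_isExposed_singleton hP.isCompact hPne
  have hxk : polyDim ({x} : Set (EuclideanSpace ℝ (Fin n))) ≤ k := by
    rw [polyDim_of_nonempty (Set.singleton_nonempty x), vectorSpan_singleton, finrank_bot]
    positivity
  have hxne : ({x} : Set (EuclideanSpace ℝ (Fin n))) ≠ P := by
    rintro rfl
    rw [vectorSpan_singleton, finrank_bot] at hdim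
    omega
  obtain ⟨i₀, hi₀⟩ := hF.exists_subset hP hx (Set.singleton_nonempty x) hxne
  have hxU := hposU {x} hx (Set.singleton_nonempty x) hxk
  set S := LinearMap.range A ⊔ Submodule.span ℝ {(1 : Fin m → ℝ)} with hS
  -- The vector `1` is not in the range, as `-1` has no positive coordinate.
  have hlt : LinearMap.range A < S := by
    refine lt_of_le_of_ne le_sup_left fun heq => ?_
    have h1 : (1 : Fin m → ℝ) ∈ LinearMap.range A := by
      rw [heq]
      exact Submodule.mem_sup_right (Submodule.mem_span_singleton_self _)
    have h2 := hxU (-1) (Submodule.neg_mem _ h1) fun i _ => by simp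
    simpa using congrFun h2 i₀
  have hrankA : Module.finrank ℝ (LinearMap.range A) = Module.finrank ℝ K := by
    refine LinearMap.finrank_range_of_inj ((injective_iff_map_eq_zero A).2 fun v hv => ?_)
    exact hpos {x} hx (Set.singleton_nonempty x) hxk v fun i _ => by simp [hv]
  have hrankK : Module.finrank ℝ (vectorSpan ℝ P) ≤ e + Module.finrank ℝ K := by
    rw [← (π.linear.domRestrict (vectorSpan ℝ P)).finrank_range_add_finrank_ker]
    refine Nat.add_le_add_right ((Submodule.finrank_le _).trans ?_) _
    rw [finrank_euclideanSpace_fin]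
  have hrankS := Submodule.finrank_lt_finrank_of_lt hlt
  have hquot := S.finrank_quotient_add_finrank
  rw [Module.finrank_fin_fun] at hquot
  -- A facet not containing the vertex `x` gives a nonzero class in the quotient.
  obtain ⟨j, hj⟩ := hF.exists_notMem hP (by omega) hxP
  have hjS : Pi.single j (1 : ℝ) ∉ S := by
    refine notMem_sup_span_one (J := {i : Fin m | {x} ⊆ F i}) (Set.nonempty_of_mem hi₀) hxU
      (fun i => ?_) ?_ fun i hi => ?_
    · exact (Pi.single_nonneg.2 zero_le_one : (0 : Fin m → ℝ) ≤ Pi.single j 1) i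
    · simp
    · refine Pi.single_eq_of_ne ?_ _
      rintro rfl
      exact hj (hi rfl)
  have hlt' : Module.finrank ℝ S < m := by
    have := Submodule.finrank_lt fun h : S = ⊤ => hjS (h ▸ Submodule.mem_top)
    rwa [Module.finrank_fin_fun] at this
  obtain ⟨N, hN⟩ : ∃ N, Module.finrank ℝ ((Fin m → ℝ) ⧸ S) = N + 1 :=
    Nat.exists_eq_succ_of_ne_zero (by omega)
  -- A simplex of the coskeleton avoids all facets through some proper face of dimension at most `k`.
  have hfaces : ∀ τ ∈ (coskeleton facet k).faces, ∃ G, IsExposed ℝ P G ∧ G.Nonempty ∧ G ≠ P ∧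
      polyDim G ≤ k ∧ ∀ i, G ⊆ F i → i ∉ τ := by
    rintro τ ⟨-, G, hGk, hdis⟩
    have hheightG : Order.height (φ G) = (k : ℕ∞) + 1 := by rw [Order.height_orderIso, hGk]
    have hne : ((φ G : FaceLattice P) : Set (EuclideanSpace ℝ (Fin n))).Nonempty := by
      by_contra hcon
      have hmin : IsMin (φ G) := fun H _ => by
        change ((φ G : FaceLattice P) : Set (EuclideanSpace ℝ (Fin n))) ⊆ H
        rw [Set.not_nonempty_iff_eq_empty.1 hcon]
        exact Set.empty_subset _
      rw [Order.height_eq_zero.2 hmin] at hheightG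
      have h0 : 0 = k + 1 := by exact_mod_cast hheightG
      omega
    refine ⟨φ G, (φ G).2, hne, fun h => ?_, ?_, fun i hi hiτ => ?_⟩
    · have h1 : φ G = ⊤ := Subtype.ext h
      rw [← map_top φ] at h1
      rw [IsKFace, φ.injective h1] at hGk
      rw [hGk] at hheight
      have h2 : d + 1 ≤ k + 1 := by exact_mod_cast hheight
      omega
    · have h1 := hP.finrank_add_one_le_height (φ G) hne
      rw [hheightG] at h1
      rw [polyDim_of_nonempty hne]
      have h2 : Module.finrank ℝ (vectorSpan ℝ ((φ G : FaceLattice P) :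
        Set (EuclideanSpace ℝ (Fin n)))) + 1 ≤ k + 1 := by exact_mod_cast h1
      exact_mod_cast Nat.le_of_succ_le_succ h2
    · have h1 : φ G ≤ φ (facet i) := hi
      exact Set.disjoint_left.1 hdis hiτ (φ.le_iff_le.1 h1)
  have hemb : EmbedsInSphere (coskeleton facet k) N := by
    refine embedsInSphere_of_submodule hN (fun τ hτ => ?_) fun τ hτ u hu hle => ?_
    · obtain ⟨G, hG, hGne, hGP, -, hGτ⟩ := hfaces τ hτ
      obtain ⟨i, hi⟩ := hF.exists_subset hP hG hGne hGP
      exact ⟨i, hGτ i hi⟩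
    · obtain ⟨G, hG, hGne, -, hGk, hGτ⟩ := hfaces τ hτ
      exact hposU G hG hGne hGk u hu fun i hi => hle i (hGτ i hi)
  have hEdim : embeddabilityDim (coskeleton facet k) ≤ N := Nat.sInf_le hemb
  omega
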